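/- Two players $1,2$ and a set $[m]=\{1,\dots,m\}$ of indivisible items are given. A profile $v=(v_1,v_2)$ consists of additive valuations $v_i(S)=\sum_{j\in S}v_{ij}$ with all $v_{ij}>0$; let $\mathcal V^{\neq}_m$ be the set of profiles such that $v_i(S)\ne v_i(T)$ for all $i\in\{1,2\}$ and all distinct $S,T\subseteq[m]$. A mechanism on $\mathcal V^{\neq}_m$ is a map $\mathcal X$ that assigns to every $v\in\mathcal V^{\neq}_m$ an ordered partition $(X_1(v),X_2(v))$ of $[m]$ (parts may be empty). It is truthful if $v_i(X_i(v))\ge v_i(X_i(v_i',v_{-i}))$ for every player $i$ and all $v,(v_i',v_{-i})\in\mathcal V^{\neq}_m$, where $(v_i',v_{-i})$ is $v$ with $v_i$ replaced by $v_i'$. It is neutral if $X_i(\sigma v)=\sigma(X_i(v))$ for every permutation $\sigma$ of $[m]$, every $v\in\mathcal V^{\neq}_m$ and every $i$, where $(\sigma v)_{i,\sigma(j)}=v_{ij}$. A set of offers on a nonempty set $S$ is a nonempty collection of proper subsets of $S$ whose union is $S$ and whose intersection is empty; the only set of offers on $\emptyset$ is $\{\emptyset\}$. A valid set of exchange deals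 on a pair $(E_1,E_2)$ of disjoint sets is a finite, possibly empty, set $D=\{(S_1,T_1),\dots,(S_k,T_k)\}$ such that $S_1,\dots,S_k$ are nonempty pairwise disjoint subsets of $E_1$ and $T_1,\dots,T_k$ are nonempty pairwise disjoint subsets of $E_2$. A deal $(S,T)$ is favorable with respect to $v$ if $v_1(T)>v_1(S)$ and $v_2(T)<v_2(S)$, and unfavorable if $v_1(T)<v_1(S)$ or $v_2(T)>v_2(S)$. A mechanism $\mathcal X$ on $\mathcal V^{\neq}_m$ is a picking-exchange mechanism with components $(N_1,N_2,E_1,E_2,\mathcal O_1,\mathcal O_2,D)$, where $(N_1,N_2,E_1,E_2)$ is a partition of $[m]$ (parts may be empty), $\mathcal O_i$ is a set of offers on $N_i$ and $D$ is a valid set of exchange deals on $(E_1,E_2)$, if for every $v\in\mathcal V^{\neq}_m$: $$X_i(v)\cap N_i\in\operatorname*{arg\,max}_{S\in\mathcal O_i}v_i(S)\quad(i=1,2),\qquad X_1(v)\cap(E_1\cup E_2)=\Big(E_1\setminus\bigcup_{j\in I}S_j\Big)\cup\bigcup_{j\in I}T_j$$ for some $I=I(v)\subseteq\{1,\dots,k\}$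 that contains the indices of all favorable deals and of no unfavorable deal with respect to $v$. **Theorem.** Every neutral, truthful mechanism on $\mathcal V^{\neq}_m$ is a picking-exchange mechanism with some components $(N_1,N_2,E_1,E_2,\mathcal O_1,\mathcal O_2,D)$ such that 1. there exists $i\in\{1,2\}$ with $E_i=[m]$, or 2. there exists $i\in\{1,2\}$ with $N_i=[m]$ and $\mathcal O_i=\{S\subseteq[m] : |S|=\kappa\}$ for some integer $\kappa$ with $0\le\kappa<m$. -/

import Mathlib

/-- A profile `v` for two players (indexed by `Fin 2`) and `m` items: `v i j` is the value of
item `j` for player `i`. -/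
abbrev Profile (m : ℕ) := Fin 2 → Fin m → ℝ

/-- The additive extension of the item values `w` to sets of items. -/
def bundleValue {m : ℕ} (w : Fin m → ℝ) (S : Finset (Fin m)) : ℝ := ∑ j ∈ S, w j

/-- All profiles with positive item values. -/
def positiveProfiles (m : ℕ) : Set (Profile m) := {v | ∀ i j, 0 < v i j}

/-- The positive profiles in which no two distinct sets of items have the same value for a
player. -/
def strictProfiles (m : ℕ) : Set (Profile m) :=
  {v | v ∈ positiveProfiles m ∧
    ∀ S T : Finset (Fin m), S ≠ T → ∀ i, bundleValue (v i) S ≠ bundleValue (v i) T}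

/-- An allocation of all the items to the two players: an ordered partition into two (possibly
empty) sets. -/
structure Allocation (m : ℕ) where
  bundle : Fin 2 → Finset (Fin m)
  disjoint : Disjoint (bundle 0) (bundle 1)
  cover : bundle 0 ∪ bundle 1 = Finset.univ

/-- A deterministic mechanism without payments, defined on the set `P` of profiles. -/
abbrev Mechanism {m : ℕ} (P : Set (Profile m)) := P → Allocation m

/-- No player `i` can profit by reporting some `w` instead of `v i`, where the misreport has to
stay within the domain `P` of the mechanism. -/
def Mechanism.Truthful {m : ℕ} {P : Set (Profile m)} (X : Mechanism P) : Prop :=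
  ∀ (v : Profile m) (hv : v ∈ P) (i : Fin 2) (w : Fin m → ℝ) (hw : Function.update v i w ∈ P),
    bundleValue (v i) ((X ⟨Function.update v i w, hw⟩).bundle i) ≤
      bundleValue (v i) ((X ⟨v, hv⟩).bundle i)

/-- The profile in which item `σ j` has the values that item `j` has in `v`. -/
def Profile.permute {m : ℕ} (σ : Equiv.Perm (Fin m)) (v : Profile m) : Profile m :=
  fun i j => v i (σ.symm j)

theorem Profile.bundleValue_permute {m : ℕ} (σ : Equiv.Perm (Fin m)) (v : Profile m) (i : Fin 2)
    (S : Finset (Fin m)) :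
    bundleValue (Profile.permute σ v i) S = bundleValue (v i) (S.map σ.symm.toEmbedding) := by
  simp [bundleValue, Profile.permute]

/-- The strict profiles are closed under permutations of the items. -/
theorem Profile.permute_mem_strictProfiles {m : ℕ} (σ : Equiv.Perm (Fin m)) {v : Profile m}
    (hv : v ∈ strictProfiles m) : Profile.permute σ v ∈ strictProfiles m := by
  refine ⟨fun i j => hv.1 i _, fun S T hST i => ?_⟩
  rw [Profile.bundleValue_permute, Profile.bundleValue_permute]
  exact hv.2 _ _ (fun h => hST (Finset.map_injective _ h)) i

/-- Neutrality: permuting the items results in the correspondingly permuted allocation. -/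
def Mechanism.Neutral {m : ℕ} (X : Mechanism (strictProfiles m)) : Prop :=
  ∀ (σ : Equiv.Perm (Fin m)) (v : Profile m) (hv : v ∈ strictProfiles m) (i : Fin 2),
    (X ⟨Profile.permute σ v, Profile.permute_mem_strictProfiles σ hv⟩).bundle i =
      ((X ⟨v, hv⟩).bundle i).map σ.toEmbedding

/-- `O` is a set of offers on `S`: a nonempty collection of proper subsets of `S` that covers `S`
and has no element common to all its members. The only set of offers on the empty set is `{∅}`
(properness is required only for nonempty `S`). -/
structure IsOfferSet {m : ℕ} (O : Finset (Finset (Fin m))) (S : Finset (Fin m)) : Prop where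
  nonempty : O.Nonempty
  subset : ∀ T ∈ O, T ⊆ S
  proper : S.Nonempty → ∀ T ∈ O, T ≠ S
  cover : ∀ x ∈ S, ∃ T ∈ O, x ∈ T
  inter : ∀ x, ∃ T ∈ O, x ∉ T

/-- The exchange deals `(S j, T j)`, `j : Fin k`, form a valid set of deals on `(E₁, E₂)`. -/
structure IsValidDeals {m k : ℕ} (S T : Fin k → Finset (Fin m)) (E₁ E₂ : Finset (Fin m)) :
    Prop where
  left_nonempty : ∀ j, (S j).Nonempty
  right_nonempty : ∀ j, (T j).Nonempty
  left_subset : ∀ j, S j ⊆ E₁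
  right_subset : ∀ j, T j ⊆ E₂
  left_disjoint : ∀ j l, j ≠ l → Disjoint (S j) (S l)
  right_disjoint : ∀ j l, j ≠ l → Disjoint (T j) (T l)

/-- The first player strictly gains by giving `A` for `B`, and so does the second by giving `B`
for `A`. -/
def Favorable {m : ℕ} (v : Profile m) (A B : Finset (Fin m)) : Prop :=
  bundleValue (v 0) A < bundleValue (v 0) B ∧ bundleValue (v 1) B < bundleValue (v 1) A

/-- At least one player strictly loses by the exchange of `A` (given by the first player) for
`B` (given by the second player). -/
def Unfavorable {m : ℕ} (v : Profile m) (A B : Finset (Fin m)) : Prop :=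
  bundleValue (v 0) B < bundleValue (v 0) A ∨ bundleValue (v 1) A < bundleValue (v 1) B

/-- The components of a picking-exchange mechanism: a partition `(N 0, N 1, E 0, E 1)` of the
items (parts may be empty), sets of offers `O i` on `N i`, and a valid set of exchange deals
`(S j, T j)` on `(E 0, E 1)`. -/
structure PickingExchange (m : ℕ) where
  N : Fin 2 → Finset (Fin m)
  E : Fin 2 → Finset (Fin m)
  cover : N 0 ∪ N 1 ∪ E 0 ∪ E 1 = Finset.univ
  disjoint_N : Disjoint (N 0) (N 1)
  disjoint_E : Disjoint (E 0) (E 1)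
  disjoint_N_E : ∀ i l, Disjoint (N i) (E l)
  O : Fin 2 → Finset (Finset (Fin m))
  offers : ∀ i, IsOfferSet (O i) (N i)
  k : ℕ
  S : Fin k → Finset (Fin m)
  T : Fin k → Finset (Fin m)
  deals : IsValidDeals S T (E 0) (E 1)

/-- The mechanism `X` is a picking-exchange mechanism with the components `Q`: in every profile,
each player `i` receives from `N i` an offer of maximum value for him, and the items of
`E 0 ∪ E 1` are allocated by performing a set `I` of the deals that contains all the favorable
and none of the unfavorable ones. -/
def Mechanism.IsImplementedBy {m : ℕ} {P : Set (Profile m)} (X : Mechanism P)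
    (Q : PickingExchange m) : Prop :=
  ∀ v : P,
    (∀ i, (X v).bundle i ∩ Q.N i ∈ Q.O i ∧
      ∀ A ∈ Q.O i, bundleValue (v.1 i) A ≤ bundleValue (v.1 i) ((X v).bundle i ∩ Q.N i)) ∧
    ∃ I : Finset (Fin Q.k),
      (X v).bundle 0 ∩ (Q.E 0 ∪ Q.E 1) = (Q.E 0 \ I.biUnion Q.S) ∪ I.biUnion Q.T ∧
      (∀ j, Favorable v.1 (Q.S j) (Q.T j) → j ∈ I) ∧
      (∀ j, Unfavorable v.1 (Q.S j) (Q.T j) → j ∉ I)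

/-! Truthfulness yields monotonicity: a player keeps the bundle when its items gain value relative
to the others. Hence an allocation survives when both players move to valuations that rank their own
bundles on top (`Mechanism.Truthful.unanimity`). With neutrality this fixes the bundle sizes
(`Mechanism.Truthful.card_eq`): otherwise, after relabelling, nested bundles `S ⊂ S'` both occur for
player 0, and one profile supports both. It remains to show that one player always gets his best
items (`Mechanism.Truthful.getsBest`). If each player sometimes gets an item `c` while preferring a
missed item `a`, relabelling produces two allocations that differ only by swapping `a` and `c`. In a
single profile where both players prefer `a` to `c`, each of them would be left with `c`. -/

/-! ### Lexicographic valuations. -/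

section Weights

variable {m : ℕ}

/-- The item values `t ^ r j`, where the exponents `r j` are distinct and ordered by the level
`f j` of the item `j` first. -/
def levelWeight (t : ℕ) (f : Fin m → ℕ) (j : Fin m) : ℝ := (t : ℝ) ^ (f j * m + j)

theorem levelExponent_injective (f : Fin m → ℕ) :
    Function.Injective fun j : Fin m => f j * m + (j : ℕ) := by
  intro j l h
  have h' := congrArg (· % m) h
  simp only [Nat.mul_add_mod_self_right, Nat.mod_eq_of_lt j.2, Nat.mod_eq_of_lt l.2] at h'
  exact Fin.ext h'

theorem levelExponent_lt {f : Fin m → ℕ} {j l : Fin m} (h : f j < f l) :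
    f j * m + (j : ℕ) < f l * m + l := by
  have h1 := Nat.mul_le_mul_right m (Nat.succ_le_of_lt h)
  have h2 := j.2
  rw [Nat.succ_mul] at h1
  omega

theorem bundleValue_levelWeight (t : ℕ) (f : Fin m → ℕ) (S : Finset (Fin m)) :
    bundleValue (levelWeight t f) S =
      ((∑ k ∈ S.image fun j : Fin m => f j * m + (j : ℕ), t ^ k : ℕ) : ℝ) := by
  rw [Finset.sum_image (fun _ _ _ _ h => levelExponent_injective f h)]
  simp [bundleValue, levelWeight]

theorem levelWeight_pos {t : ℕ} (ht : 2 ≤ t) (f : Fin m → ℕ) (j : Fin m) :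
    0 < levelWeight t f j := by
  have : (0 : ℝ) < t := by exact_mod_cast (by omega : 0 < t)
  exact pow_pos this _

/-- Bundle values are base-`t` numbers with digits 0 and 1, which determine the bundle. -/
theorem levelWeight_mem_strictProfiles {t : ℕ} (ht : 2 ≤ t) (f : Fin 2 → Fin m → ℕ) :
    (fun i => levelWeight t (f i)) ∈ strictProfiles m := by
  refine ⟨fun i j => levelWeight_pos ht _ j, fun S T hST i h => hST ?_⟩
  rw [bundleValue_levelWeight, bundleValue_levelWeight, Nat.cast_inj] at h
  exact Finset.image_injective (levelExponent_injective (f i)) (Finset.geomSum_injective ht h)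

theorem mul_levelWeight_le {t : ℕ} (ht : 2 ≤ t) {f : Fin m → ℕ} {j l : Fin m} (h : f j < f l) :
    t * levelWeight t f j ≤ levelWeight t f l := by
  have ht' : (1 : ℝ) ≤ t := by exact_mod_cast (by omega : 1 ≤ t)
  rw [levelWeight, levelWeight, ← pow_succ']
  exact pow_le_pow_right₀ ht' (levelExponent_lt h)

theorem bundleValue_mono {w : Fin m → ℝ} (hw : ∀ j, 0 < w j) {S T : Finset (Fin m)}
    (h : S ⊆ T) : bundleValue w S ≤ bundleValue w T :=
  Finset.sum_le_sum_of_subset_of_nonneg h fun j _ _ => (hw j).le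

theorem bundleValue_sdiff_le_iff (w : Fin m → ℝ) (S T : Finset (Fin m)) :
    bundleValue w (S \ T) ≤ bundleValue w (T \ S) ↔ bundleValue w S ≤ bundleValue w T := by
  have h1 := Finset.sum_inter_add_sum_sdiff S T w
  have h2 := Finset.sum_inter_add_sum_sdiff T S w
  rw [Finset.inter_comm] at h2
  unfold bundleValue
  constructor <;> intro h <;> linarith

theorem bundleValue_sdiff_lt_iff (w : Fin m → ℝ) (S T : Finset (Fin m)) :
    bundleValue w (S \ T) < bundleValue w (T \ S) ↔ bundleValue w S < bundleValue w T := by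
  rw [← not_le, ← not_le, bundleValue_sdiff_le_iff]

/-- The comparison of bundles by `levelWeight` is lexicographic. -/
theorem bundleValue_levelWeight_lt {t : ℕ} (ht : 2 ≤ t) {f : Fin m → ℕ} {A B : Finset (Fin m)}
    {j : Fin m} (hjB : j ∈ B) (hjA : j ∉ A) (h : ∀ l ∈ A, f j ≤ f l → l ∈ B) :
    bundleValue (levelWeight t f) A < bundleValue (levelWeight t f) B := by
  rw [← bundleValue_sdiff_lt_iff]
  calc bundleValue (levelWeight t f) (A \ B) < levelWeight t f j := by
        rw [bundleValue_levelWeight, levelWeight]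
        have : ∑ k ∈ (A \ B).image (fun l : Fin m => f l * m + (l : ℕ)), t ^ k <
            t ^ (f j * m + (j : ℕ)) := by
          -- Items of `A \ B` lie on levels below that of `j`, so their distinct powers of `t` sum
          -- to less than the power of `j`.
          refine Nat.geomSum_lt ht fun k hk => ?_
          obtain ⟨l, hl, rfl⟩ := Finset.mem_image.mp hk
          obtain ⟨hlA, hlB⟩ := Finset.mem_sdiff.mp hl
          exact levelExponent_lt (not_le.mp fun hle => hlB (h l hlA hle))
        exact_mod_cast this
    _ = bundleValue (levelWeight t f) {j} := by simp [bundleValue]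
    _ ≤ _ := bundleValue_mono (levelWeight_pos ht f) (by simp [hjA, hjB])

/-- A base `t` this large makes a gap between levels outweigh every ratio of values in `v`, as
monotonicity requires. -/
theorem eventually_le_mul {v : Profile m} (hv : v ∈ positiveProfiles m) :
    ∀ᶠ t : ℕ in Filter.atTop, ∀ i j l, v i j ≤ t * v i l := by
  simp only [Filter.eventually_all]
  intro i j l
  filter_upwards [tendsto_natCast_atTop_atTop.eventually_ge_atTop (v i j / v i l)] with t ht
  exact (div_le_iff₀ (hv i l)).mp ht

end Weights

/-! ### Permutations with prescribed action. -/

section Permutations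

variable {α : Type*} [DecidableEq α]

theorem exists_perm_map_eq [Fintype α] {S T : Finset α} (h : S.card = T.card) :
    ∃ σ : Equiv.Perm α, S.map σ.toEmbedding = T := by
  refine ⟨(Finset.equivOfCardEq h).extendSubtype, ?_⟩
  refine Finset.eq_of_subset_of_card_le (fun x hx => ?_) (by simp [h])
  obtain ⟨y, hy, rfl⟩ := Finset.mem_map.mp hx
  exact Equiv.extendSubtype_mem _ y hy

theorem map_swap_eq {S : Finset α} {x y : α} (h : x ∈ S ↔ y ∈ S) :
    S.map (Equiv.swap x y).toEmbedding = S := by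
  refine Finset.eq_of_subset_of_card_le (fun z hz => ?_) (by simp)
  obtain ⟨u, hu, rfl⟩ := Finset.mem_map.mp hz
  simp only [Equiv.coe_toEmbedding, Equiv.swap_apply_def]
  split_ifs with h1 h2
  · exact h.mp (h1 ▸ hu)
  · exact h.mpr (h2 ▸ hu)
  · exact hu

theorem exists_perm_map_eq_apply_eq [Fintype α] {S T : Finset α} (h : S.card = T.card) {c a c' a' : α}
    (hc : c ∈ S) (ha : a ∉ S) (hc' : c' ∈ T) (ha' : a' ∉ T) :
    ∃ σ : Equiv.Perm α, S.map σ.toEmbedding = T ∧ σ c = c' ∧ σ a = a' := by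
  obtain ⟨σ, hσ⟩ := exists_perm_map_eq h
  have hcT : σ c ∈ T := by rw [← hσ]; simpa using hc
  have haT : σ a ∉ T := by rw [← hσ]; simpa using ha
  -- Each swap acts within `T` or within its complement, so the image of `S` is unaffected.
  refine ⟨(σ.trans (Equiv.swap (σ c) c')).trans (Equiv.swap (σ a) a'), ?_, ?_, ?_⟩
  · rw [Equiv.trans_toEmbedding, ← Finset.map_map, Equiv.trans_toEmbedding, ← Finset.map_map, hσ,
      map_swap_eq (iff_of_true hcT hc'), map_swap_eq (iff_of_false haT ha')]
  · simp only [Equiv.trans_apply, Equiv.swap_apply_left]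
    exact Equiv.swap_apply_of_ne_of_ne (fun e => haT (e ▸ hc')) (fun e => ha' (e ▸ hc'))
  · simp only [Equiv.trans_apply]
    rw [Equiv.swap_apply_of_ne_of_ne (x := σ a) (fun e => haT (e ▸ hcT)) (fun e => haT (e ▸ hc')),
      Equiv.swap_apply_left]

end Permutations

/-! ### Monotonicity, unanimity and constant bundle sizes. -/

section Mechanisms

variable {m : ℕ}

theorem Allocation.bundle_eq_compl (A : Allocation m) {i o : Fin 2} (h : o ≠ i) :
    A.bundle o = (A.bundle i)ᶜ := by
  have h01 : IsCompl (A.bundle 0) (A.bundle 1) :=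
    ⟨A.disjoint, codisjoint_iff.mpr (by simpa using A.cover)⟩
  fin_cases i <;> fin_cases o <;> first | exact absurd rfl h | skip
  · exact h01.compl_eq.symm
  · exact h01.symm.compl_eq.symm

theorem Mechanism.Truthful.le {P : Set (Profile m)} {X : Mechanism P} (hX : X.Truthful) (v w : P)
    (i : Fin 2) (h : ∀ o, o ≠ i → w.1 o = v.1 o) :
    bundleValue (v.1 i) ((X w).bundle i) ≤ bundleValue (v.1 i) ((X v).bundle i) := by
  obtain ⟨v, hv⟩ := v
  obtain ⟨w, hw⟩ := w
  have e : w = Function.update v i (w i) := by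
    funext o
    by_cases ho : o = i
    · subst ho; simp
    · simpa [ho] using h o ho
  have key := hX v hv i (w i) (e ▸ hw)
  simpa only [← e] using key

/-- A player's bundle does not change when the relative values of its items increase. -/
theorem Mechanism.Truthful.monotone {X : Mechanism (strictProfiles m)} (hX : X.Truthful)
    (v w : strictProfiles m) (i : Fin 2) (h : ∀ o, o ≠ i → w.1 o = v.1 o)
    (hvw : ∀ j ∈ (X v).bundle i, ∀ l ∉ (X v).bundle i,
      w.1 i l * v.1 i j ≤ w.1 i j * v.1 i l) :
    (X w).bundle i = (X v).bundle i := by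
  by_contra hne
  set S := (X v).bundle i
  set T := (X w).bundle i
  have h1 : bundleValue (v.1 i) (T \ S) < bundleValue (v.1 i) (S \ T) :=
    (bundleValue_sdiff_lt_iff _ _ _).mpr
      (lt_of_le_of_ne (hX.le v w i h) (v.2.2 T S hne i))
  have h2 : bundleValue (w.1 i) (S \ T) < bundleValue (w.1 i) (T \ S) :=
    (bundleValue_sdiff_lt_iff _ _ _).mpr
      (lt_of_le_of_ne (hX.le w v i fun o ho => (h o ho).symm) (w.2.2 S T (Ne.symm hne) i))
  -- Summing the item-wise ratio condition contradicts the product of the two revealed preferences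
  -- `h1` and `h2`.
  have h3 : bundleValue (w.1 i) (T \ S) * bundleValue (v.1 i) (S \ T) ≤
      bundleValue (w.1 i) (S \ T) * bundleValue (v.1 i) (T \ S) := by
    rw [bundleValue, bundleValue, Finset.sum_mul_sum, Finset.sum_comm, bundleValue, bundleValue,
      Finset.sum_mul_sum]
    refine Finset.sum_le_sum fun j hj => Finset.sum_le_sum fun l hl => ?_
    exact hvw j (Finset.mem_sdiff.mp hj).1 l (Finset.mem_sdiff.mp hl).2
  have h4 := mul_lt_mul'' h2 h1 (Finset.sum_nonneg fun j _ => (w.2.1 i j).le)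
    (Finset.sum_nonneg fun j _ => (v.2.1 i j).le)
  exact absurd h3 (not_le.mpr h4)

theorem Mechanism.Truthful.monotone_levelWeight {X : Mechanism (strictProfiles m)}
    (hX : X.Truthful) (v w : strictProfiles m) (i : Fin 2) (h : ∀ o, o ≠ i → w.1 o = v.1 o)
    {t : ℕ} (ht : 2 ≤ t) (htv : ∀ j l, v.1 i j ≤ t * v.1 i l) {f : Fin m → ℕ}
    (hw : w.1 i = levelWeight t f)
    (hf : ∀ j ∈ (X v).bundle i, ∀ l ∉ (X v).bundle i, f l < f j) :
    (X w).bundle i = (X v).bundle i := by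
  refine hX.monotone v w i h fun j hj l hl => ?_
  rw [hw]
  calc levelWeight t f l * v.1 i j ≤ levelWeight t f l * (t * v.1 i l) :=
        mul_le_mul_of_nonneg_left (htv j l) (levelWeight_pos ht f l).le
    _ = t * levelWeight t f l * v.1 i l := by ring
    _ ≤ levelWeight t f j * v.1 i l :=
        mul_le_mul_of_nonneg_right (mul_levelWeight_le ht (hf j hj l hl)) (v.2.1 i l).le

theorem update_mem_strictProfiles {v w : Profile m} (hv : v ∈ strictProfiles m)
    (hw : w ∈ strictProfiles m) (i : Fin 2) : Function.update v i (w i) ∈ strictProfiles m := by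
  refine ⟨fun o j => ?_, fun S T hST o => ?_⟩ <;> by_cases ho : o = i
  · subst ho; simpa using hw.1 o j
  · simpa [ho] using hv.1 o j
  · subst ho; simpa using hw.2 S T hST o
  · simpa [ho] using hv.2 S T hST o

/-- If both players come to want their bundles most, then they keep them. -/
theorem Mechanism.Truthful.unanimity {X : Mechanism (strictProfiles m)} (hX : X.Truthful)
    (v w : strictProfiles m) {t : ℕ} (ht : 2 ≤ t) (htv : ∀ i j l, v.1 i j ≤ t * v.1 i l)
    {f : Fin 2 → Fin m → ℕ} (hw : ∀ i, w.1 i = levelWeight t (f i))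
    (hf : ∀ i, ∀ j ∈ (X v).bundle i, ∀ l ∉ (X v).bundle i, f i l < f i j) :
    (X w).bundle 0 = (X v).bundle 0 := by
  let u : strictProfiles m := ⟨Function.update v.1 0 (w.1 0), update_mem_strictProfiles v.2 w.2 0⟩
  have h0 : (X u).bundle 0 = (X v).bundle 0 :=
    hX.monotone_levelWeight v u 0 (fun o ho => by simp [u, ho]) ht (htv 0)
      (by simp [u, hw]) (hf 0)
  have h1 : (X u).bundle 1 = (X v).bundle 1 := by
    rw [(X u).bundle_eq_compl one_ne_zero, h0, ← (X v).bundle_eq_compl one_ne_zero]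
  have h2 : (X w).bundle 1 = (X u).bundle 1 := by
    refine hX.monotone_levelWeight u w 1 (fun o ho => ?_) ht (by simpa [u] using htv 1) (hw 1)
      (by rw [h1]; exact hf 1)
    have : o = 0 := by omega
    subst this
    simp [u]
  rw [(X w).bundle_eq_compl zero_ne_one, h2, h1, ← (X v).bundle_eq_compl zero_ne_one]

/-- Neutrality together with truthfulness fixes the number of items that each player gets. -/
theorem Mechanism.Truthful.card_le {X : Mechanism (strictProfiles m)} (hX : X.Truthful)
    (hneutral : X.Neutral) (v v' : strictProfiles m) :
    ((X v').bundle 0).card ≤ ((X v).bundle 0).card := by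
  by_contra! hlt
  obtain ⟨S', hSS', hcard⟩ := Finset.exists_superset_card_eq hlt.le
    (by simpa using Finset.card_le_univ ((X v').bundle 0))
  obtain ⟨σ, hσ⟩ := exists_perm_map_eq hcard.symm
  let u : strictProfiles m := ⟨_, Profile.permute_mem_strictProfiles σ v'.2⟩
  have hu : (X u).bundle 0 = S' := (hneutral σ v'.1 v'.2 0).trans hσ
  set S := (X v).bundle 0
  -- Player 0 ranks `S`, then `S' \ S`, then the rest; player 1 ranks in reverse. Both `S` and `S'`
  -- are thus top sets for player 0, and their complements for player 1.
  let f : Fin 2 → Fin m → ℕ := fun i j =>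
    if i = 0 then (if j ∈ S then 2 else if j ∈ S' then 1 else 0)
    else (if j ∈ S then 0 else if j ∈ S' then 1 else 2)
  obtain ⟨t, ⟨ht, htv⟩, htu⟩ := ((Filter.eventually_ge_atTop 2).and
    (eventually_le_mul v.2.1)).and (eventually_le_mul u.2.1) |>.exists
  let w : strictProfiles m := ⟨_, levelWeight_mem_strictProfiles ht f⟩
  have h1 : (X w).bundle 0 = S := by
    refine hX.unanimity v w ht htv (f := f) (fun _ => rfl) fun i => ?_
    fin_cases i
    · intro j hj l hl
      have hj' : j ∈ S := hj
      have hl' : l ∉ S := hl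
      simp [f, hj', hl']
      split_ifs <;> simp
    · simp only [Fin.mk_one, (X v).bundle_eq_compl one_ne_zero,
        Finset.mem_compl, not_not]
      intro j hj l hl
      have hj' : j ∉ S := hj
      have hl' : l ∈ S := hl
      simp [f, hj', hl']
      split_ifs <;> simp
  have h2 : (X w).bundle 0 = S' := by
    refine (hX.unanimity u w ht htu (f := f) (fun _ => rfl) fun i => ?_).trans hu
    fin_cases i
    · simp only [Fin.zero_eta, hu]
      intro j hj l hl
      have hl' : l ∉ S := fun h => hl (hSS' h)
      simp [f, hj, hl, hl']
      split_ifs <;> simp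
    · simp only [Fin.mk_one, (X u).bundle_eq_compl one_ne_zero,
        Finset.mem_compl, not_not, hu]
      intro j hj l hl
      have hj' : j ∉ S := fun h => hj (hSS' h)
      simp [f, hj, hl, hj']
      split_ifs <;> simp
  exact hlt.ne (by rw [← hcard, ← h2, h1])

theorem Mechanism.Truthful.card_eq {X : Mechanism (strictProfiles m)} (hX : X.Truthful)
    (hneutral : X.Neutral) (v v' : strictProfiles m) (i : Fin 2) :
    ((X v').bundle i).card = ((X v).bundle i).card := by
  have h0 := le_antisymm (hX.card_le hneutral v v') (hX.card_le hneutral v' v)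
  by_cases hi : i = 0
  · rw [hi, h0]
  · rw [(X v').bundle_eq_compl hi, (X v).bundle_eq_compl hi, Finset.card_compl,
      Finset.card_compl, h0]

/-! ### One player always gets his best items. -/

/-- The levels of a player who wants first the items of `S` other than `a` and `c`, then `a`,
then `c`, then the rest. -/
def pivotLevel (S : Finset (Fin m)) (a c j : Fin m) : ℕ :=
  if j = a then 2 else if j = c then 1 else if j ∈ S then 3 else 0

theorem pivotLevel_congr {S T : Finset (Fin m)} {a c : Fin m}
    (h : ∀ j, j ≠ a → j ≠ c → (j ∈ S ↔ j ∈ T)) : pivotLevel S a c = pivotLevel T a c := by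
  funext j
  unfold pivotLevel
  split_ifs <;> simp_all

/-- Lexicographically, `A` cannot miss any item of `C` other than `c`; the cardinality then leaves
one free place, which only `c` or the better item `a` can fill. -/
theorem eq_or_eq_of_bundleValue_pivotLevel_le {t : ℕ} (ht : 2 ≤ t) {C A : Finset (Fin m)}
    {a c : Fin m} (hc : c ∈ C) (ha : a ∉ C) (hcard : A.card = C.card)
    (hle : bundleValue (levelWeight t (pivotLevel C a c)) C ≤
      bundleValue (levelWeight t (pivotLevel C a c)) A) :
    A = C ∨ A = insert a (C.erase c) := by
  have hac : a ≠ c := fun e => ha (e ▸ hc)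
  have hsub : C.erase c ⊆ A := by
    intro j hj
    by_contra hjA
    obtain ⟨hjc, hjC⟩ := Finset.mem_erase.mp hj
    have hja : j ≠ a := fun e => ha (e ▸ hjC)
    refine absurd hle (not_le.mpr (bundleValue_levelWeight_lt ht hjC hjA fun l _ h => ?_))
    by_contra hlC
    simp only [pivotLevel, hja, hjc, hjC, hlC] at h
    split_ifs at h <;> simp_all
  by_cases hcA : c ∈ A
  · left
    refine (Finset.eq_of_subset_of_card_le ?_ hcard.le).symm
    rw [← Finset.insert_erase hc]
    exact Finset.insert_subset hcA hsub
  right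
  have haA : a ∈ A := by
    by_contra haA
    refine absurd hle (not_le.mpr (bundleValue_levelWeight_lt ht hc hcA fun l hl h => ?_))
    by_contra hlC
    have hla : l ≠ a := fun e => haA (e ▸ hl)
    have hlc : l ≠ c := fun e => hlC (e ▸ hc)
    simp [pivotLevel, hac.symm, hla, hlc, hlC] at h
  refine (Finset.eq_of_subset_of_card_le (Finset.insert_subset haA hsub) ?_).symm
  rw [hcard, Finset.card_insert_of_notMem (fun h => ha (Finset.mem_of_mem_erase h)),
    Finset.card_erase_add_one hc]

/-- If player `i` gets `c` but not the item `a`, which he values more, then he still fails to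
get `a` in place of `c` when both players want `a` more than `c` and only disagree on `a`. -/
theorem Mechanism.Truthful.bundle_pivot {X : Mechanism (strictProfiles m)} (hX : X.Truthful)
    (hneutral : X.Neutral) (v : strictProfiles m) {i : Fin 2} {a c : Fin m}
    (hc : c ∈ (X v).bundle i) (ha : a ∉ (X v).bundle i) (hv : v.1 i c < v.1 i a) {t : ℕ}
    (ht : 2 ≤ t) (htv : ∀ i j l, v.1 i j ≤ t * v.1 i l) (w : strictProfiles m)
    (hw : ∀ o, w.1 o = levelWeight t (pivotLevel ((X v).bundle o) a c)) :
    (X w).bundle i = (X v).bundle i := by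
  obtain ⟨o, hoi⟩ : ∃ o : Fin 2, o ≠ i := exists_ne i
  have hcases : ∀ k, k = i ∨ k = o := fun k => by omega
  let u : strictProfiles m := ⟨Function.update v.1 o (w.1 o), update_mem_strictProfiles v.2 w.2 o⟩
  have hui : u.1 i = v.1 i := by simp [u, hoi.symm]
  -- The other player owns `a` and not `c`, so his new levels put his whole bundle on top.
  have huo : (X u).bundle o = (X v).bundle o := by
    refine hX.monotone_levelWeight v u o (fun k hk => by simp [u, hk]) ht (htv o)
      (f := pivotLevel ((X v).bundle o) a c) (by simp [u, hw]) ?_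
    simp only [(X v).bundle_eq_compl hoi, Finset.mem_compl, not_not]
    intro j hj l hl
    have hjc : j ≠ c := fun e => hj (e ▸ hc)
    have hla : l ≠ a := fun e => ha (e ▸ hl)
    simp only [pivotLevel, hjc, hla, Finset.mem_compl, hj, hl]
    split_ifs <;> simp_all
  have hu : (X u).bundle i = (X v).bundle i := by
    rw [(X u).bundle_eq_compl hoi.symm, huo, ← (X v).bundle_eq_compl hoi.symm]
  have hwu : ∀ k, k ≠ i → w.1 k = u.1 k := fun k hk => by
    rw [(hcases k).resolve_left hk]; simp [u]
  have h1 := hX.le w u i fun k hk => (hwu k hk).symm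
  rw [hu, hw i] at h1
  refine (eq_or_eq_of_bundleValue_pivotLevel_le ht hc ha (hX.card_eq hneutral v w i)
    h1).resolve_right fun h => ?_
  -- Obtaining `a` in place of `c` at `w` would be a profitable misreport at `u`, where player `i`
  -- still has his values from `v`.
  have h2 := hX.le u w i hwu
  rw [h, hu, hui, bundleValue, Finset.sum_insert fun h => ha (Finset.mem_of_mem_erase h),
    bundleValue, ← Finset.add_sum_erase _ _ hc] at h2
  linarith

/-- In every profile, player `i` values each item that he gets at least as much as each item that
he does not get. -/
def Mechanism.GetsBest (X : Mechanism (strictProfiles m)) (i : Fin 2) : Prop :=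
  ∀ v, ∀ c ∈ (X v).bundle i, ∀ a ∉ (X v).bundle i, v.1 i a ≤ v.1 i c

theorem Mechanism.Truthful.getsBest {X : Mechanism (strictProfiles m)} (hX : X.Truthful)
    (hneutral : X.Neutral) : X.GetsBest 0 ∨ X.GetsBest 1 := by
  by_contra! h
  obtain ⟨h0, h1⟩ := h
  unfold Mechanism.GetsBest at h0 h1
  push Not at h0 h1
  obtain ⟨v, c, hc, a, ha, hv⟩ := h0
  obtain ⟨v', c', hc', a', ha', hv'⟩ := h1
  have hac : a ≠ c := fun e => ha (e ▸ hc)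
  have hv1 : (X v).bundle 1 = ((X v).bundle 0)ᶜ := (X v).bundle_eq_compl (by simp)
  have hc1 : c ∉ (X v).bundle 1 := by simpa [hv1] using hc
  have ha1 : a ∈ (X v).bundle 1 := by simpa [hv1] using ha
  -- Player 1's bundle in `v` after the exchange of `a` for `c`; neutrality moves the second
  -- counterexample to it.
  set B := insert c (((X v).bundle 1).erase a)
  have hcard : ((X v').bundle 1).card = B.card := by
    rw [hX.card_eq hneutral v v' 1,
      Finset.card_insert_of_notMem (fun h => hc1 (Finset.mem_of_mem_erase h)),
      Finset.card_erase_add_one ha1]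
  obtain ⟨σ, hσ, hσc, hσa⟩ := exists_perm_map_eq_apply_eq hcard hc' ha'
    (Finset.mem_insert_self _ _ : c ∈ B) (by simp [B, hac] : a ∉ B)
  let u : strictProfiles m := ⟨_, Profile.permute_mem_strictProfiles σ v'.2⟩
  have hu : (X u).bundle 1 = B := (hneutral σ v'.1 v'.2 1).trans hσ
  have hulow : u.1 1 c < u.1 1 a := by simpa [u, Profile.permute, ← hσc, ← hσa] using hv'
  obtain ⟨t, ⟨ht, htv⟩, htu⟩ := ((Filter.eventually_ge_atTop 2).and
    (eventually_le_mul v.2.1)).and (eventually_le_mul u.2.1) |>.exists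
  let w : strictProfiles m :=
    ⟨_, levelWeight_mem_strictProfiles ht fun o => pivotLevel ((X v).bundle o) a c⟩
  have e0 := hX.bundle_pivot hneutral v hc ha hv ht htv w fun _ => rfl
  have e1 := hX.bundle_pivot hneutral u (i := 1) (a := a) (c := c) (by simp [hu, B])
    (by simp [hu, B, hac]) hulow ht htu w fun o => by
      -- Pivot levels ignore whether `a` and `c` belong to the set, so the same `w` serves `v` and
      -- `u`.
      refine congrArg (levelWeight t) (pivotLevel_congr fun j hja hjc => ?_)
      by_cases ho : o = 1
      · subst ho
        simp [hu, B, hja, hjc]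
      · rw [(X v).bundle_eq_compl ho, (X u).bundle_eq_compl ho, hu]
        simp [B, hja, hjc]
  have hcw : c ∈ (X w).bundle 1 := by rw [e1, hu]; exact Finset.mem_insert_self _ _
  rw [(X w).bundle_eq_compl one_ne_zero, e0] at hcw
  exact Finset.mem_compl.mp hcw hc

/-- Match `A \ C` bijectively with `C \ A` and compare item by item. -/
theorem bundleValue_le_of_card_eq {w : Fin m → ℝ} {C A : Finset (Fin m)}
    (h : ∀ c ∈ C, ∀ a ∉ C, w a ≤ w c) (hcard : A.card = C.card) :
    bundleValue w A ≤ bundleValue w C := by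
  rw [← bundleValue_sdiff_le_iff]
  have hcard' : (A \ C).card = (C \ A).card := Finset.card_sdiff_comm hcard
  let e := Finset.equivOfCardEq hcard'
  rw [bundleValue, bundleValue, ← Finset.sum_coe_sort, ← Finset.sum_coe_sort (C \ A),
    ← e.sum_comp]
  exact Finset.sum_le_sum fun x _ =>
    h _ (Finset.mem_sdiff.mp (e x).2).1 _ (Finset.mem_sdiff.mp x.2).2

end Mechanisms

/-! ### Explicit components. -/

section Components

variable {m : ℕ}

theorem isOfferSet_empty : IsOfferSet ({∅} : Finset (Finset (Fin m))) ∅ where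
  nonempty := Finset.singleton_nonempty _
  subset := by simp
  proper := by simp
  cover := by simp
  inter := by simp

theorem isOfferSet_powersetCard {κ : ℕ} (h0 : 0 < κ) (hm : κ < m) :
    IsOfferSet (Finset.powersetCard κ (Finset.univ : Finset (Fin m))) Finset.univ where
  nonempty := Finset.powersetCard_nonempty.mpr (by simpa using hm.le)
  subset := by simp
  proper := by
    rintro - T hT rfl
    simp at hT
    omega
  cover := by
    intro x _
    obtain ⟨T, hxT, hT⟩ := Finset.exists_superset_card_eq (s := {x}) (n := κ)
      (by simpa using Nat.succ_le_of_lt h0)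
      (by simpa using hm.le)
    exact ⟨T, by simpa using hT, by simpa using hxT⟩
  inter := by
    intro x
    obtain ⟨T, hxT, hT⟩ := Finset.exists_subset_card_eq (s := Finset.univ.erase x) (n := κ)
      (by simpa [Finset.card_erase_of_mem] using Nat.le_sub_one_of_lt hm)
    exact ⟨T, by simpa using hT, fun h => Finset.notMem_erase x _ (hxT h)⟩

theorem Finset.disjoint_ite_univ_empty {α ι : Type*} [Fintype α] [DecidableEq ι] (i : ι)
    {j l : ι} (h : j ≠ l) :
    Disjoint (if j = i then (Finset.univ : Finset α) else ∅) (if l = i then Finset.univ else ∅) := by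
  split_ifs with h1 h2 <;> simp_all

/-- The components of the mechanism that gives all items to player `i`. -/
def PickingExchange.giveAll (m : ℕ) (i : Fin 2) : PickingExchange m where
  N _ := ∅
  E l := if l = i then Finset.univ else ∅
  cover := by fin_cases i <;> simp
  disjoint_N := by simp
  disjoint_E := Finset.disjoint_ite_univ_empty i (by simp)
  disjoint_N_E := by simp
  O _ := {∅}
  offers _ := isOfferSet_empty
  k := 0
  S := Fin.elim0
  T := Fin.elim0
  deals := ⟨by simp, by simp, by simp, by simp, by simp, by simp⟩

/-- The components of the mechanism that lets player `i` pick any `κ` items. -/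
def PickingExchange.pick (i : Fin 2) {κ : ℕ} (h0 : 0 < κ) (hm : κ < m) : PickingExchange m where
  N l := if l = i then Finset.univ else ∅
  E _ := ∅
  cover := by fin_cases i <;> simp
  disjoint_N := Finset.disjoint_ite_univ_empty i (by simp)
  disjoint_E := by simp
  disjoint_N_E := by simp
  O l := if l = i then Finset.powersetCard κ Finset.univ else {∅}
  offers l := by
    by_cases h : l = i
    · simpa [h] using isOfferSet_powersetCard h0 hm
    · simpa [h] using isOfferSet_empty
  k := 0
  S := Fin.elim0
  T := Fin.elim0
  deals := ⟨by simp, by simp, by simp, by simp, by simp, by simp⟩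

theorem Mechanism.isImplementedBy_giveAll {P : Set (Profile m)} {X : Mechanism P} {i : Fin 2}
    (h : ∀ v, (X v).bundle i = Finset.univ) :
    X.IsImplementedBy (PickingExchange.giveAll m i) := by
  refine fun v => ⟨fun l => by simp [PickingExchange.giveAll], ∅, ?_, fun j => j.elim0,
    fun j => j.elim0⟩
  fin_cases i
  · have h1 : (X v).bundle 0 = Finset.univ := h v
    simp [PickingExchange.giveAll, h1]
  · have h1 : (X v).bundle 0 = ((X v).bundle 1)ᶜ := (X v).bundle_eq_compl (by simp)
    have h2 : (X v).bundle 1 = Finset.univ := h v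
    simp [PickingExchange.giveAll, h1, h2]
    rfl

theorem Mechanism.isImplementedBy_pick {X : Mechanism (strictProfiles m)} {i : Fin 2}
    (hbest : X.GetsBest i) {κ : ℕ} (h0 : 0 < κ) (hm : κ < m)
    (hcard : ∀ v, ((X v).bundle i).card = κ) :
    X.IsImplementedBy (PickingExchange.pick i h0 hm) := by
  refine fun v => ⟨fun l => ?_, ∅, by simp [PickingExchange.pick]; rfl,
    fun j => j.elim0, fun j => j.elim0⟩
  by_cases hl : l = i
  · subst hl
    simp only [PickingExchange.pick, if_true, Finset.inter_univ, Finset.mem_powersetCard_univ]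
    exact ⟨hcard v, fun A hA => bundleValue_le_of_card_eq (hbest v) (hA.trans (hcard v).symm)⟩
  · simp [PickingExchange.pick, hl]

/-- A player who always gets his best items, in constant number, either gets everything, or leaves
everything to the other player, or picks. -/
theorem Mechanism.GetsBest.exists_pickingExchange {X : Mechanism (strictProfiles m)} {i : Fin 2}
    (hbest : X.GetsBest i) {κ : ℕ} (hcard : ∀ v, ((X v).bundle i).card = κ) (hκ : κ ≤ m) :
    ∃ Q : PickingExchange m, X.IsImplementedBy Q ∧
      ((∃ i : Fin 2, Q.E i = Finset.univ) ∨
        (∃ i : Fin 2, Q.N i = Finset.univ ∧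
          ∃ κ : ℕ, κ < m ∧ Q.O i = Finset.powersetCard κ Finset.univ)) := by
  -- For `m > 0`, the `κ`-subsets form no set of offers at the extremes: `κ = 0` fails to cover, and
  -- `κ = m` is not proper. There the components come from `E` instead.
  rcases Nat.eq_zero_or_pos κ with h0 | h0
  · obtain ⟨o, ho⟩ : ∃ o : Fin 2, o ≠ i := exists_ne i
    refine ⟨_, Mechanism.isImplementedBy_giveAll (i := o) fun v => ?_, .inl ⟨o, ?_⟩⟩
    · rw [(X v).bundle_eq_compl ho, Finset.card_eq_zero.mp ((hcard v).trans h0),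
        Finset.compl_empty]
    · simp [PickingExchange.giveAll]
  rcases hκ.eq_or_lt with hm | hm
  · refine ⟨_, Mechanism.isImplementedBy_giveAll (i := i) fun v => ?_, .inl ⟨i, ?_⟩⟩
    · exact (Finset.card_eq_iff_eq_univ _).mp (by simpa [hm] using hcard v)
    · simp [PickingExchange.giveAll]
  · refine ⟨_, Mechanism.isImplementedBy_pick hbest h0 hm hcard, .inr ⟨i, ?_, κ, hm, ?_⟩⟩ <;>
      simp [PickingExchange.pick]

end Components

theorem mainTheorem12 (m : ℕ) (X : Mechanism (strictProfiles m))
    (hneutral : X.Neutral) (htruthful : X.Truthful) :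
    ∃ Q : PickingExchange m, X.IsImplementedBy Q ∧
      ((∃ i : Fin 2, Q.E i = Finset.univ) ∨
        (∃ i : Fin 2, Q.N i = Finset.univ ∧
          ∃ κ : ℕ, κ < m ∧ Q.O i = Finset.powersetCard κ Finset.univ)) := by
  -- Any strict profile serves to name the constant sizes; here item `j` has value `2 ^ j`.
  let w : strictProfiles m := ⟨_, levelWeight_mem_strictProfiles le_rfl fun _ _ => 0⟩
  have hcard := fun i v => htruthful.card_eq hneutral w v i
  have hκ : ∀ i, ((X w).bundle i).card ≤ m := fun i => by
    simpa using Finset.card_le_univ ((X w).bundle i)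
  rcases htruthful.getsBest hneutral with h | h
  · exact h.exists_pickingExchange (hcard 0) (hκ 0)
  · exact h.exists_pickingExchange (hcard 1) (hκ 1)
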